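/- A seller offers $m$ items to a single risk-neutral unit-demand buyer. The buyer's type $(t_0,t_1,\dots,t_m)$ consists of independent nonnegative random variables, $t_i$ having an arbitrary distribution $F_i$ on $[0,\infty)$, and her value for item $j\in\{1,\dots,m\}$ is $v_j=t_0+t_j$. A *lottery* is a vector $\ell=(q_1,\dots,q_m,p)$ with $q_j\ge 0$, $\sum_j q_j\le 1$ and price $p\in\mathbb R$; its utility to the buyer is $\sum_j q_jv_j-p$. A *lottery pricing* $\mathcal L$ is an arbitrary collection of lotteries. The buyer selects one lottery of $\mathcal L$, or none (utility and payment $0$), maximizing her utility, with ties broken by an arbitrary measurable rule; it is assumed that a utility-maximizing choice exists for almost every $v$. $\mathrm{Rev}[\mathcal L]$ is the expected price paid. An *item pricing* $\mathbf p=(p_1,\dots,p_m)\in[0,\infty)^m$ is the lottery pricing that offers each item $j$ with certainty at price $p_j$. Then, for every lottery pricing $\mathcal L$ and every tie-breaking rule for it: 1. If $\mathrm{Rev}[\mathcal L]$ is finite (the price paid is integrable), there is an item pricing $\mathbf p$ such that $\mathrm{Rev}[\mathcal L]\le 8\,\mathrm{Rev}[\mathbf p]$, however the buyer breaks ties when facing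 $\mathbf p$. 2. If the price paid under $\mathcal L$ is not integrable (infinite revenue), then item pricings have unbounded revenue: for every real $K$ there is an item pricing $\mathbf p$ with $\mathrm{Rev}[\mathbf p]\ge K$, however the buyer breaks ties. -/

import Mathlib

open MeasureTheory

noncomputable section

/-- An `m`-dimensional lottery: item `j` is allocated with probability `prob j` (with the remaining
probability nothing is allocated), and `price` is paid. -/
structure Lottery (m : ℕ) where
  prob : Fin m → ℝ
  price : ℝ
  prob_nonneg : ∀ j, 0 ≤ prob j
  prob_sum_le_one : ∑ j, prob j ≤ 1

/-- Buying nothing: no item is allocated and nothing is paid. -/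
def Lottery.noPurchase (m : ℕ) : Lottery m where
  prob := fun _ => 0
  price := 0
  prob_nonneg := fun _ => le_refl 0
  prob_sum_le_one := by simp

/-- The deterministic lottery that allocates item `j` with certainty at price `x`. -/
def Lottery.item {m : ℕ} (j : Fin m) (x : ℝ) : Lottery m where
  prob := fun k => if k = j then 1 else 0
  price := x
  prob_nonneg := fun k => by split_ifs <;> norm_num
  prob_sum_le_one := by simp

/-- Expected utility of a risk-neutral unit-demand buyer with values `v` from buying a lottery. -/
def Lottery.utility {m : ℕ} (l : Lottery m) (v : Fin m → ℝ) : ℝ :=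
  ∑ j, l.prob j * v j - l.price

/-- A lottery pricing: an arbitrary (possibly infinite) collection of lotteries on offer. -/
abbrev LotteryPricing (m : ℕ) : Type := Set (Lottery m)

/-- The item pricing `p`, offering each item `j` at price `p j`, as a lottery pricing. -/
def itemPricing {m : ℕ} (p : Fin m → ℝ) : LotteryPricing m :=
  Set.range fun j => Lottery.item j (p j)

/-- `l` is a utility-maximizing choice for a buyer with values `v` who may select any one lottery
of `L`, or none. -/
def IsBestChoice {m : ℕ} (L : LotteryPricing m) (v : Fin m → ℝ) (l : Lottery m) : Prop :=
  l ∈ insert (Lottery.noPurchase m) L ∧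
    ∀ l' ∈ insert (Lottery.noPurchase m) L, l'.utility v ≤ l.utility v

/-- `c` describes the behaviour of a rational buyer facing `L`, when values have law `μ`: at almost
every value vector `v` she selects the utility-maximizing option `c v`. Ties are broken in an
arbitrary (measurable) way. -/
structure IsRationalChoice {m : ℕ} (μ : Measure (Fin m → ℝ)) (L : LotteryPricing m)
    (c : (Fin m → ℝ) → Lottery m) : Prop where
  best : ∀ᵐ v ∂μ, IsBestChoice L v (c v)
  aemeasurable_prob : ∀ j, AEMeasurable (fun v => (c v).prob j) μ
  aemeasurable_price : AEMeasurable (fun v => (c v).price) μ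

/-- The seller's expected revenue exists as a real number. -/
def HasFiniteRevenue {m : ℕ} (μ : Measure (Fin m → ℝ)) (c : (Fin m → ℝ) → Lottery m) : Prop :=
  Integrable (fun v => (c v).price) μ

/-- The seller's expected revenue when the buyer behaves according to `c`. -/
def expectedRevenue {m : ℕ} (μ : Measure (Fin m → ℝ)) (c : (Fin m → ℝ) → Lottery m) : ℝ :=
  ∫ v, (c v).price ∂μ

/-- The values of a buyer of type `(t 0, …, t m)`: item `j ∈ {1, …, m}` is worth `t 0 + t j`. -/
def additiveValue {m : ℕ} (t : Fin (m + 1) → ℝ) : Fin m → ℝ :=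
  fun j => t 0 + t j.succ

/-- The law of the buyer's values when the type coordinates are independent, `t i` having
distribution `F i`. -/
def additiveValueLaw {m : ℕ} (F : Fin (m + 1) → Measure ℝ) : Measure (Fin m → ℝ) :=
  (Measure.pi F).map additiveValue

end

/-!
A buyer of type `(t 0, …, t m)` is regarded as `m + 1` independent single-parameter agents: agent `0`
is served when any item is allocated, agent `j + 1` when item `j` is. Let `R > 0` bound what every
item pricing is guaranteed to earn; the theorem follows once the positive part of the price paid
under a lottery pricing is shown to have expectation at most `15 R / 2 < 8 R`.

*Upper bound on lotteries.* With the other coordinates fixed, a lottery pricing is an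
incentive-compatible mechanism for the coordinate `t i`, whose indirect utility is convex with slopes
in `[0, 1]`. Such a mechanism is a randomization over posted prices, so at cost `ν` its profit is at
most `sup_{r ≥ ν} (r - ν) P(t i > r)` (`lintegral_profit_le`). The same bound applies to the
second-price auction with reserve `ν`. Pointwise, the price paid is at most `2 ν` plus the profits of
the lottery pricing from single coordinates, plus second-price profits (`price_le_decomposition`): the
largest coordinate is charged for itself, the others are charged to the second-highest value. Agent
`0` is given cost `0`, the other agents a common cost `ν`.

*Lower bound on item pricings.* A uniform price `r` earns at least `r P(t 0 > r)`. Item prices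
`p j ≥ ν` earn at least `ν (1 - b) + b ∑ j, (p j - ν) P(t (j + 1) > p j)`, where `b` is the
probability that no `t (j + 1)` exceeds its price: an item that alone has `t (j + 1) > p j` is bought
whatever `t 0` is (`item_prices_le_expectedRevenue`). For `ν = 5 R / 4` this implies
`∑ j, sup_{r ≥ ν} (r - ν) P(t (j + 1) > r) ≤ R`, without any continuity of the distributions.

*Total.* The two bounds give `2 ν + 2 R + 3 R = 15 R / 2` (`lintegral_price_le`). As the price paid is
bounded below, the finiteness of this bound also yields integrability
(`hasFiniteRevenue_of_lintegral_lt_top`), which is the second claim.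
-/

/-! ### Single-parameter mechanisms and posted prices -/

/-- To bound an integral over a product of probability spaces, it is enough to bound the integral
over one coordinate, uniformly in the others. No measurability is needed: the lower integral is
that of a measurable minorant. -/
theorem lintegral_pi_le_of_forall_update {ι : Type*} [Fintype ι] [DecidableEq ι]
    (F : ι → Measure ℝ) [∀ i, IsProbabilityMeasure (F i)] (i : ι) (f : (ι → ℝ) → ENNReal)
    (C : ENNReal) (h : ∀ t, ∫⁻ s, f (Function.update t i s) ∂(F i) ≤ C) :
    ∫⁻ t, f t ∂(Measure.pi F) ≤ C := by
  obtain ⟨g, hg, hgf, hfg⟩ := exists_measurable_le_lintegral_eq (Measure.pi F) f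
  rw [hfg]
  calc ∫⁻ t, g t ∂(Measure.pi F) ≤ ∫⁻ _, C ∂(Measure.pi F) := by
        refine lintegral_le_of_lmarginal_le {i} hg measurable_const fun t => ?_
        rw [lmarginal_singleton, lmarginal_singleton]
        simp only [lintegral_const, measure_univ, mul_one]
        exact (lintegral_mono fun s => hgf _).trans (h t)
    _ = C := by simp

/-- Extrapolating a chord of a convex function to the left of the chord gives a lower bound. -/
theorem ConvexOn.chord_extrapolate_le {W : ℝ → ℝ} (hW : ConvexOn ℝ Set.univ W) {s a δ : ℝ}
    (hδ : 0 < δ) (hs : s ≤ a) : W a - (W (a + δ) - W a) / δ * (a - s) ≤ W s := by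
  rcases hs.eq_or_lt with rfl | hs
  · simp
  have h := hW.slope_mono_adjacent (Set.mem_univ s) (Set.mem_univ (a + δ)) hs (by linarith)
  rw [add_sub_cancel_left, div_le_iff₀ (by linarith)] at h
  linarith

/-- The payment extracted by a tangent at a point of a grid cell is at most the payment extracted
by the chord over the next cell, which by Abel summation is the revenue of a randomized posted
price supported on the grid `ν, ν + δ, ν + 2δ, …`. -/
theorem tangent_payment_le_sum {W : ℝ → ℝ} (hconv : ConvexOn ℝ Set.univ W) (h0 : ∀ s, 0 ≤ W s)
    {ν δ s x : ℝ} (hδ : 0 < δ) (hx : ∀ s', W s + x * (s' - s) ≤ W s') (k : ℕ)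
    (hk : ν + k * δ < s) (hk' : s ≤ ν + (k + 1) * δ)
    (g : ℕ → ℝ) (hg : ∀ n : ℕ, g n = (W (ν + n * δ + δ) - W (ν + n * δ)) / δ) :
    (s - ν) * x - W s ≤ ∑ n ∈ Finset.range (k + 1), (n * δ + δ) * (g (n + 1) - g n) := by
  have hsum : ∀ k : ℕ, (k * δ) * g k - W (ν + k * δ) ≤
      ∑ n ∈ Finset.range k, (n * δ + δ) * (g (n + 1) - g n) := by
    intro k
    induction k with
    | zero => simpa using h0 _
    | succ k ih =>
      rw [Finset.sum_range_succ]
      have hgk : W (ν + k * δ + δ) = W (ν + k * δ) + δ * g k := by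
        rw [hg k]; field_simp; ring
      have e : ν + ((k + 1 : ℕ) : ℝ) * δ = ν + k * δ + δ := by push_cast; ring
      rw [e, hgk]
      push_cast
      linarith
  refine le_trans ?_ (hsum (k + 1))
  have hch := hconv.chord_extrapolate_le hδ (s := s) (a := ν + ((k + 1 : ℕ) : ℝ) * δ)
    (by push_cast; exact hk')
  rw [← hg (k + 1)] at hch
  set a : ℝ := ν + ((k + 1 : ℕ) : ℝ) * δ with ha
  have hgk : W (a + δ) = W a + δ * g (k + 1) := by
    rw [hg (k + 1), ← ha]; field_simp; ring
  have has : s ≤ a := by rw [ha]; push_cast; exact hk'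
  have hxg : x ≤ g (k + 1) := by
    have h1 := hx (a + δ)
    have h2 : x * (a + δ - s) ≤ g (k + 1) * (a + δ - s) := by linarith
    exact le_of_mul_le_mul_right h2 (by linarith)
  have hsν : 0 ≤ s - ν := by
    have : 0 ≤ (k : ℝ) * δ := by positivity
    linarith
  have h3 : (s - ν) * x ≤ (s - ν) * g (k + 1) := mul_le_mul_of_nonneg_left hxg hsν
  have h4 : ((k + 1 : ℕ) : ℝ) * δ = a - ν := by rw [ha]; ring
  rw [h4]
  linarith

/-- For a single buyer of value distributed as `μ`, no incentive-compatible mechanism beats posted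
prices, in the version where the seller has a cost `ν`. Here `W` is the indirect utility, its
subgradient `x` is the probability of service, and `f` is at most the profit `(s - ν) * x - W s`. -/
theorem lintegral_profit_le (μ : Measure ℝ) (W : ℝ → ℝ) (hconv : ConvexOn ℝ Set.univ W)
    (hmono : Monotone W) (hlip : ∀ s h, 0 ≤ h → W (s + h) ≤ W s + h) (h0 : ∀ s, 0 ≤ W s)
    {ν C : ℝ}
    (hC : ∀ r, ν ≤ r → ENNReal.ofReal (r - ν) * μ (Set.Ioi r) ≤ ENNReal.ofReal C)
    (hμ : μ Set.univ ≤ 1) (f : ℝ → ℝ)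
    (hf : ∀ s, f s ≤ 0 ∨ ∃ x, (∀ s', W s + x * (s' - s) ≤ W s') ∧ f s ≤ (s - ν) * x - W s) :
    ∫⁻ s, ENNReal.ofReal (f s) ∂μ ≤ ENNReal.ofReal C := by
  -- A grid of mesh `δ` loses an additive `δ`.
  suffices H : ∀ δ : ℝ, 0 < δ →
      ∫⁻ s, ENNReal.ofReal (f s) ∂μ ≤ ENNReal.ofReal C + ENNReal.ofReal δ by
    refine ENNReal.le_of_forall_pos_le_add fun ε hε _ => ?_
    simpa using H ε (by exact_mod_cast hε)
  intro δ hδ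
  set g : ℕ → ℝ := fun n => (W (ν + n * δ + δ) - W (ν + n * δ)) / δ with hg
  have hgmono : ∀ n, 0 ≤ g (n + 1) - g n := by
    intro n
    have e : ν + ((n + 1 : ℕ) : ℝ) * δ = ν + n * δ + δ := by push_cast; ring
    have h := hconv.slope_mono_adjacent (Set.mem_univ (ν + n * δ))
      (Set.mem_univ (ν + n * δ + δ + δ)) (y := ν + n * δ + δ) (by linarith) (by linarith)
    simp only [hg, e]
    simp only [add_sub_cancel_left] at h
    linarith
  have hg0 : 0 ≤ g 0 := div_nonneg (sub_nonneg.2 (hmono (by linarith))) hδ.le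
  have hg1 : ∀ n, g n ≤ 1 := fun n => by
    rw [hg, div_le_one hδ]
    have := hlip (ν + n * δ) δ hδ.le
    linarith
  have hnδ : ∀ n : ℕ, (0 : ℝ) ≤ n * δ := fun n => by positivity
  have hpt : ∀ s, ENNReal.ofReal (f s) ≤
      ∑' n : ℕ, (Set.Ioi (ν + n * δ)).indicator
        (fun _ => ENNReal.ofReal ((n * δ + δ) * (g (n + 1) - g n))) s := by
    intro s
    rcases hf s with h | ⟨x, hx, hfx⟩
    · simp [ENNReal.ofReal_of_nonpos h]
    rcases le_or_gt s ν with hs | hs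
    · have hx0 : 0 ≤ x := by
        have h1 := hx (s - 1)
        have h2 : W (s - 1) ≤ W s := hmono (by linarith)
        linarith
      have : f s ≤ 0 := by
        have := h0 s
        have := mul_nonpos_of_nonpos_of_nonneg (sub_nonpos.2 hs) hx0
        linarith
      simp [ENNReal.ofReal_of_nonpos this]
    · obtain ⟨k, hk, hk'⟩ : ∃ k : ℕ, ν + k * δ < s ∧ s ≤ ν + (k + 1) * δ := by
        have hpos : 0 < ⌈(s - ν) / δ⌉₊ := Nat.ceil_pos.2 (div_pos (by linarith) hδ)
        obtain ⟨k, hk⟩ := Nat.exists_eq_succ_of_ne_zero hpos.ne'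
        refine ⟨k, ?_, ?_⟩
        · have : (k : ℝ) < (s - ν) / δ := Nat.lt_ceil.1 (by omega)
          rw [lt_div_iff₀ hδ] at this
          linarith
        · have := Nat.le_ceil ((s - ν) / δ)
          rw [hk, div_le_iff₀ hδ] at this
          push_cast at this
          linarith
      have hle := hfx.trans (tangent_payment_le_sum hconv h0 hδ hx k hk hk' g fun _ => rfl)
      calc ENNReal.ofReal (f s)
          ≤ ENNReal.ofReal (∑ n ∈ Finset.range (k + 1), (n * δ + δ) * (g (n + 1) - g n)) :=
            ENNReal.ofReal_le_ofReal hle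
        _ = ∑ n ∈ Finset.range (k + 1), ENNReal.ofReal ((n * δ + δ) * (g (n + 1) - g n)) :=
            ENNReal.ofReal_sum_of_nonneg fun n _ =>
              mul_nonneg (add_nonneg (hnδ n) hδ.le) (hgmono n)
        _ = ∑ n ∈ Finset.range (k + 1), (Set.Ioi (ν + n * δ)).indicator
              (fun _ => ENNReal.ofReal ((n * δ + δ) * (g (n + 1) - g n))) s := by
            refine Finset.sum_congr rfl fun n hn => ?_
            rw [Set.indicator_of_mem]
            have : (n : ℝ) * δ ≤ k * δ := by
              gcongr
              exact Nat.lt_succ_iff.1 (Finset.mem_range.1 hn)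
            exact lt_of_le_of_lt (by linarith) hk
        _ ≤ _ := ENNReal.sum_le_tsum _
  calc ∫⁻ s, ENNReal.ofReal (f s) ∂μ
      ≤ ∫⁻ s, ∑' n : ℕ, (Set.Ioi (ν + n * δ)).indicator
        (fun _ => ENNReal.ofReal ((n * δ + δ) * (g (n + 1) - g n))) s ∂μ := lintegral_mono hpt
    _ = ∑' n : ℕ, ENNReal.ofReal ((n * δ + δ) * (g (n + 1) - g n)) *
          μ (Set.Ioi (ν + n * δ)) := by
        rw [lintegral_tsum fun n => (measurable_const.indicator measurableSet_Ioi).aemeasurable]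
        exact tsum_congr fun n => lintegral_indicator_const measurableSet_Ioi _
    _ ≤ ∑' n : ℕ, ENNReal.ofReal (g (n + 1) - g n) *
          (ENNReal.ofReal C + ENNReal.ofReal δ) := by
        refine ENNReal.tsum_le_tsum fun n => ?_
        rw [mul_comm (n * δ + δ), ENNReal.ofReal_mul (hgmono n), mul_assoc,
          ENNReal.ofReal_add (hnδ n) hδ.le, add_mul]
        gcongr
        · have := hC (ν + n * δ) (by linarith [hnδ n])
          simpa using this
        · exact mul_le_of_le_one_right' ((measure_mono (Set.subset_univ _)).trans hμ)
    _ = (∑' n : ℕ, ENNReal.ofReal (g (n + 1) - g n)) *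
          (ENNReal.ofReal C + ENNReal.ofReal δ) := ENNReal.tsum_mul_right
    _ ≤ 1 * (ENNReal.ofReal C + ENNReal.ofReal δ) := by
        gcongr
        refine ENNReal.tsum_le_of_sum_range_le fun N => ?_
        rw [← ENNReal.ofReal_sum_of_nonneg fun n _ => hgmono n, Finset.sum_range_sub]
        exact ENNReal.ofReal_le_one.2 (by linarith [hg1 N])
    _ = _ := one_mul _

/-! ### The indirect utility of a lottery pricing -/

/-- The probability with which a lottery serves each type coordinate, when a buyer of type
`(t 0, …, t m)` is regarded as `m + 1` agents: the base coordinate `t 0` is served whenever any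
item is allocated, the coordinate `t (j + 1)` when item `j` is. -/
noncomputable def Lottery.serviceProb {m : ℕ} (l : Lottery m) : Fin (m + 1) → ℝ :=
  Fin.cons (∑ j, l.prob j) l.prob

theorem Lottery.serviceProb_nonneg {m : ℕ} (l : Lottery m) (i : Fin (m + 1)) :
    0 ≤ l.serviceProb i := by
  refine Fin.cases ?_ (fun j => ?_) i
  · exact Finset.sum_nonneg (s := Finset.univ) fun j _ => l.prob_nonneg j
  · exact l.prob_nonneg j

theorem Lottery.prob_le_one {m : ℕ} (l : Lottery m) (j : Fin m) : l.prob j ≤ 1 :=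
  (Finset.single_le_sum (fun k _ => l.prob_nonneg k) (Finset.mem_univ j)).trans l.prob_sum_le_one

theorem Lottery.serviceProb_le_one {m : ℕ} (l : Lottery m) (i : Fin (m + 1)) :
    l.serviceProb i ≤ 1 := by
  refine Fin.cases ?_ (fun j => ?_) i
  · exact l.prob_sum_le_one
  · exact l.prob_le_one j

theorem Lottery.utility_additiveValue {m : ℕ} (l : Lottery m) (t : Fin (m + 1) → ℝ) :
    l.utility (additiveValue t) = ∑ i, l.serviceProb i * t i - l.price := by
  simp only [Lottery.utility, additiveValue, Lottery.serviceProb, Fin.sum_univ_succ, Fin.cons_zero,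
    Fin.cons_succ, mul_add, Finset.sum_add_distrib, Finset.sum_mul]

theorem Lottery.utility_update {m : ℕ} (l : Lottery m) (t : Fin (m + 1) → ℝ) (i : Fin (m + 1))
    (s s' : ℝ) : l.utility (additiveValue (Function.update t i s')) =
      l.utility (additiveValue (Function.update t i s)) + l.serviceProb i * (s' - s) := by
  have key : ∀ s, ∑ k, l.serviceProb k * Function.update t i s k =
      l.serviceProb i * s + ∑ k ∈ Finset.univ.erase i, l.serviceProb k * t k := by
    intro s
    rw [← Finset.add_sum_erase _ _ (Finset.mem_univ i), Function.update_self]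
    congr 1
    refine Finset.sum_congr rfl fun k hk => ?_
    rw [Function.update_of_ne (Finset.ne_of_mem_erase hk)]
  rw [Lottery.utility_additiveValue, Lottery.utility_additiveValue, key, key]
  ring

/-- The utility that a buyer with values `v` can secure when facing `L`. The supremum is used also
at the values where it is not attained, so that it is meaningful only if it is finite. -/
noncomputable def indirectUtility {m : ℕ} (L : LotteryPricing m) (v : Fin m → ℝ) : ℝ :=
  ⨆ l : ↥(insert (Lottery.noPurchase m) L), l.1.utility v

/-- Every buyer, whatever her values, has a finite indirect utility. -/
def HasFiniteUtility {m : ℕ} (L : LotteryPricing m) : Prop :=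
  ∀ v, BddAbove (Set.range fun l : ↥(insert (Lottery.noPurchase m) L) => l.1.utility v)

/-- Utilities are Lipschitz in the values uniformly over all lotteries, so that one buyer for whom
a best choice exists bounds the utility of all others. -/
theorem IsBestChoice.hasFiniteUtility {m : ℕ} {L : LotteryPricing m} {v₀ : Fin m → ℝ}
    {l₀ : Lottery m} (h : IsBestChoice L v₀ l₀) : HasFiniteUtility L := by
  intro v
  refine ⟨l₀.utility v₀ + ∑ j, |v j - v₀ j|, ?_⟩
  rintro _ ⟨⟨l, hl⟩, rfl⟩
  have h1 := h.2 l hl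
  have h2 : ∑ j, l.prob j * v j ≤ ∑ j, l.prob j * v₀ j + ∑ j, |v j - v₀ j| := by
    rw [← Finset.sum_add_distrib]
    refine Finset.sum_le_sum fun j _ => ?_
    have h3 : l.prob j * (v j - v₀ j) ≤ |v j - v₀ j| :=
      (mul_le_mul_of_nonneg_left (le_abs_self _) (l.prob_nonneg j)).trans
        (mul_le_of_le_one_left (abs_nonneg _) (l.prob_le_one j))
    linarith
  simp only [Lottery.utility] at h1 ⊢
  linarith

theorem HasFiniteUtility.utility_le {m : ℕ} {L : LotteryPricing m} (hL : HasFiniteUtility L)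
    {l : Lottery m} (hl : l ∈ insert (Lottery.noPurchase m) L) (v : Fin m → ℝ) :
    l.utility v ≤ indirectUtility L v :=
  le_ciSup (hL v) (⟨l, hl⟩ : ↥(insert (Lottery.noPurchase m) L))

theorem indirectUtility_le {m : ℕ} {L : LotteryPricing m} {v : Fin m → ℝ} {b : ℝ}
    (h : ∀ l ∈ insert (Lottery.noPurchase m) L, l.utility v ≤ b) : indirectUtility L v ≤ b :=
  have : Nonempty ↥(insert (Lottery.noPurchase m) L) := ⟨⟨_, Set.mem_insert _ _⟩⟩
  ciSup_le fun l => h l.1 l.2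

theorem IsBestChoice.utility_eq {m : ℕ} {L : LotteryPricing m} {v : Fin m → ℝ} {l : Lottery m}
    (h : IsBestChoice L v l) : l.utility v = indirectUtility L v :=
  le_antisymm (h.hasFiniteUtility.utility_le h.1 v) (indirectUtility_le h.2)

theorem IsBestChoice.utility_nonneg {m : ℕ} {L : LotteryPricing m} {v : Fin m → ℝ} {l : Lottery m}
    (h : IsBestChoice L v l) : 0 ≤ l.utility v := by
  simpa [Lottery.utility, Lottery.noPurchase] using h.2 _ (Set.mem_insert _ _)

theorem HasFiniteUtility.indirectUtility_nonneg {m : ℕ} {L : LotteryPricing m}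
    (hL : HasFiniteUtility L) (v : Fin m → ℝ) : 0 ≤ indirectUtility L v := by
  simpa [Lottery.utility, Lottery.noPurchase] using hL.utility_le (Set.mem_insert _ _) v

theorem HasFiniteUtility.convexOn_section {m : ℕ} {L : LotteryPricing m} (hL : HasFiniteUtility L)
    (t : Fin (m + 1) → ℝ) (i : Fin (m + 1)) :
    ConvexOn ℝ Set.univ fun s => indirectUtility L (additiveValue (Function.update t i s)) := by
  refine ⟨convex_univ, fun s _ s' _ a b ha hb hab => indirectUtility_le fun l hl => ?_⟩
  have h1 := mul_le_mul_of_nonneg_left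
    (hL.utility_le hl (additiveValue (Function.update t i s))) ha
  have h2 := mul_le_mul_of_nonneg_left
    (hL.utility_le hl (additiveValue (Function.update t i s'))) hb
  rw [l.utility_update t i 0] at h1 h2 ⊢
  simp only [smul_eq_mul] at h1 h2 ⊢
  have hb' : b = 1 - a := by linarith
  subst hb'
  linarith

theorem HasFiniteUtility.monotone_section {m : ℕ} {L : LotteryPricing m} (hL : HasFiniteUtility L)
    (t : Fin (m + 1) → ℝ) (i : Fin (m + 1)) :
    Monotone fun s => indirectUtility L (additiveValue (Function.update t i s)) := by
  intro s s' hs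
  refine indirectUtility_le fun l hl => le_trans ?_ (hL.utility_le hl _)
  rw [l.utility_update t i s s']
  have := mul_nonneg (l.serviceProb_nonneg i) (sub_nonneg.2 hs)
  linarith

theorem HasFiniteUtility.section_add_le {m : ℕ} {L : LotteryPricing m} (hL : HasFiniteUtility L)
    (t : Fin (m + 1) → ℝ) (i : Fin (m + 1)) (s h : ℝ) (hh : 0 ≤ h) :
    indirectUtility L (additiveValue (Function.update t i (s + h))) ≤
      indirectUtility L (additiveValue (Function.update t i s)) + h := by
  refine indirectUtility_le fun l hl => ?_
  rw [l.utility_update t i s (s + h)]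
  have h1 := hL.utility_le hl (additiveValue (Function.update t i s))
  have h2 := mul_le_of_le_one_left hh (l.serviceProb_le_one i)
  rw [add_sub_cancel_left]
  linarith

/-- Coordinate by coordinate, the profit of a lottery pricing is at most that of posted prices:
with all other coordinates fixed, a lottery pricing is an incentive-compatible mechanism for the
single coordinate `t i`. -/
theorem lintegral_coordinate_profit_le {m : ℕ} (F : Fin (m + 1) → Measure ℝ)
    [∀ i, IsProbabilityMeasure (F i)] {L : LotteryPricing m} (hL : HasFiniteUtility L)
    (c : (Fin m → ℝ) → Lottery m)
    (hc : ∀ᵐ t ∂(Measure.pi F), IsBestChoice L (additiveValue t) (c (additiveValue t)))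
    (i : Fin (m + 1)) {ν C : ℝ}
    (hC : ∀ r, ν ≤ r → ENNReal.ofReal (r - ν) * F i (Set.Ioi r) ≤ ENNReal.ofReal C) :
    ∫⁻ t, ENNReal.ofReal ((t i - ν) * (c (additiveValue t)).serviceProb i -
      (c (additiveValue t)).utility (additiveValue t)) ∂(Measure.pi F) ≤ ENNReal.ofReal C := by
  classical
  -- The types without a best choice are discarded, so that the bound below holds at every type.
  set f : (Fin (m + 1) → ℝ) → ℝ := fun t =>
    if IsBestChoice L (additiveValue t) (c (additiveValue t)) then
      (t i - ν) * (c (additiveValue t)).serviceProb i -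
        (c (additiveValue t)).utility (additiveValue t) else 0 with hf
  have hae : ∫⁻ t, ENNReal.ofReal ((t i - ν) * (c (additiveValue t)).serviceProb i -
      (c (additiveValue t)).utility (additiveValue t)) ∂(Measure.pi F) =
      ∫⁻ t, ENNReal.ofReal (f t) ∂(Measure.pi F) := by
    refine lintegral_congr_ae (hc.mono fun t ht => ?_)
    simp only [hf, if_pos ht]
  rw [hae]
  refine lintegral_pi_le_of_forall_update F i _ _ fun t => ?_
  refine lintegral_profit_le (F i) _ (hL.convexOn_section t i) (hL.monotone_section t i)
    (hL.section_add_le t i) (fun s => hL.indirectUtility_nonneg _) hC (by simp) _ fun s => ?_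
  simp only [hf]
  split_ifs with hs
  · refine Or.inr ⟨(c (additiveValue (Function.update t i s))).serviceProb i, fun s' => ?_, ?_⟩
    · rw [← hs.utility_eq, ← Lottery.utility_update]
      exact hL.utility_le hs.1 _
    · rw [← hs.utility_eq, Function.update_self]
  · exact Or.inl le_rfl

/-! ### Second-price auctions -/

/-- The price that agent `i` has to beat in a second-price auction with reserve `ν`: the maximum
of `ν` and the values of all other agents. -/
noncomputable def topRival {n : ℕ} (ν : ℝ) (i : Fin n) (t : Fin n → ℝ) : ℝ :=
  ⨆ k, if k = i then ν else max ν (t k)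

/-- The profit, at cost `ν`, that the second-price auction with reserve `ν` makes from agent `i`.
At ties every top agent is counted as a winner. -/
noncomputable def secondPriceProfit {n : ℕ} (ν : ℝ) (i : Fin n) (t : Fin n → ℝ) : ℝ :=
  if topRival ν i t ≤ t i then topRival ν i t - ν else 0

section SecondPrice

variable {n : ℕ} (ν : ℝ) (i : Fin n) (t : Fin n → ℝ)

theorem le_topRival : ν ≤ topRival ν i t :=
  (by simp : ν ≤ if i = i then ν else max ν (t i)).trans
    (le_ciSup (f := fun k => if k = i then ν else max ν (t k)) (Finite.bddAbove_range _) i)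

theorem apply_le_topRival {k : Fin n} (hk : k ≠ i) : t k ≤ topRival ν i t :=
  (by simp [hk] : t k ≤ if k = i then ν else max ν (t k)).trans
    (le_ciSup (f := fun k => if k = i then ν else max ν (t k)) (Finite.bddAbove_range _) k)

theorem topRival_le {b : ℝ} (hν : ν ≤ b) (h : ∀ k, t k ≤ b) : topRival ν i t ≤ b := by
  have : Nonempty (Fin n) := ⟨i⟩
  refine ciSup_le fun k => ?_
  split_ifs
  · exact hν
  · exact max_le hν (h k)

theorem topRival_update (s : ℝ) : topRival ν i (Function.update t i s) = topRival ν i t := by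
  refine iSup_congr fun k => ?_
  split_ifs with hk
  · rfl
  · rw [Function.update_of_ne hk]

theorem secondPriceProfit_nonneg : 0 ≤ secondPriceProfit ν i t := by
  unfold secondPriceProfit
  split_ifs
  · exact sub_nonneg.2 (le_topRival ν i t)
  · exact le_rfl

theorem measurable_secondPriceProfit : Measurable (secondPriceProfit ν i) := by
  have h : Measurable (topRival ν i) := by
    refine Measurable.iSup fun k => ?_
    split_ifs
    · exact measurable_const
    · exact measurable_const.max (measurable_pi_apply k)
  exact Measurable.ite (measurableSet_le h (measurable_pi_apply i)) (h.sub_const ν)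
    measurable_const

end SecondPrice

/-- A second-price auction, being incentive compatible, extracts from each agent at most what
posted prices do. -/
theorem lintegral_secondPriceProfit_le {n : ℕ} (F : Fin n → Measure ℝ)
    [∀ i, IsProbabilityMeasure (F i)] (i : Fin n) {ν C : ℝ}
    (hC : ∀ r, ν ≤ r → ENNReal.ofReal (r - ν) * F i (Set.Ioi r) ≤ ENNReal.ofReal C) :
    ∫⁻ t, ENNReal.ofReal (secondPriceProfit ν i t) ∂(Measure.pi F) ≤ ENNReal.ofReal C := by
  refine lintegral_pi_le_of_forall_update F i _ _ fun t => ?_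
  set B := topRival ν i t with hB
  -- The agent's utility is `max (s - B) 0`, served with probability `1` or `0`.
  refine lintegral_profit_le (F i) (fun s => max (s - B) 0) ?_ ?_ ?_ (fun s => le_max_right _ _)
    hC (by simp) _ fun s => ?_
  · exact ((convexOn_id convex_univ).sub (concaveOn_const B convex_univ)).sup
      (convexOn_const 0 convex_univ)
  · exact fun s s' h => max_le_max (by linarith) le_rfl
  · intro s h hh
    refine max_le ?_ ?_
    · have := le_max_left (s - B) 0
      linarith
    · have := le_max_right (s - B) 0
      linarith
  · unfold secondPriceProfit
    rw [topRival_update, Function.update_self, ← hB]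
    split_ifs with hs
    · refine Or.inr ⟨1, fun s' => ?_, ?_⟩
      · rw [max_eq_left (by linarith)]
        exact le_trans (by linarith) (le_max_left _ _)
      · rw [max_eq_left (by linarith)]
        linarith
    · exact Or.inl le_rfl

/-! ### Decomposition of the price paid -/

/-- The decomposition of the price paid. If the base coordinate is the largest, the allocation of
the items is charged to the second-price auction won by the base coordinate. Otherwise let item
coordinate `j` be the largest: the base coordinate and the items other than `j` are each charged to
the second-price auction won by `j`, whence the factor `2`. The utility is subtracted only once,
from the profit of the winner. -/
theorem price_le_decomposition {m : ℕ} (l : Lottery m) (t : Fin (m + 1) → ℝ) (ht : ∀ i, 0 ≤ t i)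
    {ν : ℝ} (hν : 0 ≤ ν) :
    l.price ≤ 2 * ν + (max ((t 0 - 0) * l.serviceProb 0 - l.utility (additiveValue t)) 0 +
      secondPriceProfit 0 0 t) +
      ∑ j : Fin m, (max ((t j.succ - ν) * l.serviceProb j.succ - l.utility (additiveValue t)) 0 +
        2 * secondPriceProfit ν j.succ t) := by
  have hprice : l.price = ∑ i, l.serviceProb i * t i - l.utility (additiveValue t) := by
    rw [l.utility_additiveValue]; ring
  set u := l.utility (additiveValue t)
  have hsum0 : ∀ j : Fin m, 0 ≤
      max ((t j.succ - ν) * l.serviceProb j.succ - u) 0 + 2 * secondPriceProfit ν j.succ t :=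
    fun j => add_nonneg (le_max_right _ _)
      (mul_nonneg zero_le_two (secondPriceProfit_nonneg _ _ _))
  have hx0 : l.serviceProb 0 = ∑ j, l.prob j := rfl
  have hxs : ∀ j : Fin m, l.serviceProb j.succ = l.prob j := fun j => rfl
  have hm0 := le_max_left ((t 0 - 0) * l.serviceProb 0 - u) 0
  have hm0' := le_max_right ((t 0 - 0) * l.serviceProb 0 - u) 0
  have hS0 := secondPriceProfit_nonneg 0 0 t
  rw [hprice, Fin.sum_univ_succ]
  by_cases h0 : ∀ j : Fin m, t j.succ ≤ t 0
  · have hwin : secondPriceProfit 0 0 t = topRival 0 0 t := by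
      rw [secondPriceProfit, if_pos, sub_zero]
      exact topRival_le _ _ _ (ht 0) fun k => Fin.cases le_rfl h0 k
    have hrest : ∑ j : Fin m, l.serviceProb j.succ * t j.succ ≤ topRival 0 0 t := by
      calc ∑ j : Fin m, l.serviceProb j.succ * t j.succ
          ≤ ∑ j : Fin m, l.prob j * topRival 0 0 t := Finset.sum_le_sum fun j _ =>
            mul_le_mul_of_nonneg_left (apply_le_topRival _ _ _ (Fin.succ_ne_zero j))
              (l.prob_nonneg j)
        _ = (∑ j : Fin m, l.prob j) * topRival 0 0 t := by rw [Finset.sum_mul]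
        _ ≤ topRival 0 0 t := mul_le_of_le_one_left (le_topRival _ _ _) l.prob_sum_le_one
    have := Finset.sum_nonneg fun j (_ : j ∈ Finset.univ) => hsum0 j
    linarith
  · push Not at h0
    obtain ⟨j₁, hj₁⟩ := h0
    have : Nonempty (Fin m) := ⟨j₁⟩
    obtain ⟨j, hj⟩ := Finite.exists_max fun j : Fin m => t j.succ
    have htop : ∀ k, t k ≤ t j.succ := fun k =>
      Fin.cases (hj₁.le.trans (hj j₁)) (fun k => hj k) k
    have hsingle := Finset.single_le_sum (fun k _ => hsum0 k) (Finset.mem_univ j)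
    have hmj := le_max_left ((t j.succ - ν) * l.serviceProb j.succ - u) 0
    have hmj' := le_max_right ((t j.succ - ν) * l.serviceProb j.succ - u) 0
    have hSj := secondPriceProfit_nonneg ν j.succ t
    have hq1 : ∑ k, l.prob k = l.prob j + ∑ k ∈ Finset.univ.erase j, l.prob k :=
      (Finset.add_sum_erase _ _ (Finset.mem_univ j)).symm
    have hq : ∑ k ∈ Finset.univ.erase j, l.prob k ≤ 1 - l.prob j := by
      have := l.prob_sum_le_one
      linarith
    -- If `b` bounds all values but the winner's, the base coordinate contributes at most `b`, and
    -- so do the losing items, weighted with their total probability.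
    have hlose : ∀ b, 0 ≤ b → (∀ k, k ≠ j.succ → t k ≤ b) →
        l.serviceProb 0 * t 0 + ∑ k ∈ Finset.univ.erase j, l.prob k * t k.succ ≤
          b + (1 - l.prob j) * b := by
      intro b hb hkb
      have h1 : l.serviceProb 0 * t 0 ≤ b :=
        (mul_le_of_le_one_left (ht 0) (l.serviceProb_le_one 0)).trans
          (hkb 0 (Fin.succ_ne_zero j).symm)
      have h2 : ∑ k ∈ Finset.univ.erase j, l.prob k * t k.succ ≤
          (∑ k ∈ Finset.univ.erase j, l.prob k) * b := by
        rw [Finset.sum_mul]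
        refine Finset.sum_le_sum fun k hk => mul_le_mul_of_nonneg_left (hkb _ ?_) (l.prob_nonneg k)
        exact fun h => Finset.ne_of_mem_erase hk (Fin.succ_injective _ h)
      have := mul_le_mul_of_nonneg_right hq hb
      linarith
    have hsplit : ∑ k : Fin m, l.serviceProb k.succ * t k.succ =
        l.prob j * t j.succ + ∑ k ∈ Finset.univ.erase j, l.prob k * t k.succ :=
      (Finset.add_sum_erase _ (fun k : Fin m => l.prob k * t k.succ) (Finset.mem_univ j)).symm
    rw [hsplit]
    rw [hxs] at hmj hmj' hsingle
    have hp0 := l.prob_nonneg j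
    have hp1 := l.prob_le_one j
    rcases le_total ν (t j.succ) with hνt | hνt
    · have hwin : secondPriceProfit ν j.succ t = topRival ν j.succ t - ν := by
        rw [secondPriceProfit, if_pos]
        exact topRival_le _ _ _ hνt htop
      have hb := le_topRival ν j.succ t
      have := hlose (topRival ν j.succ t) (hν.trans hb) fun k hk => apply_le_topRival _ _ _ hk
      have h3 : (1 - l.prob j) * (topRival ν j.succ t - ν) ≤ topRival ν j.succ t - ν :=
        mul_le_of_le_one_left (by linarith) (by linarith)
      rw [hwin] at hsingle
      simp only [hxs] at hsingle ⊢
      linarith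
    · have := hlose ν hν fun k _ => (htop k).trans hνt
      have h3 : l.prob j * t j.succ ≤ l.prob j * ν := mul_le_mul_of_nonneg_left hνt hp0
      simp only [hxs] at hsingle ⊢
      linarith

/-! ### Revenue guarantees of item pricings -/

theorem Lottery.utility_noPurchase {m : ℕ} (v : Fin m → ℝ) :
    (Lottery.noPurchase m).utility v = 0 := by
  simp [Lottery.utility, Lottery.noPurchase]

theorem Lottery.utility_item {m : ℕ} (j : Fin m) (x : ℝ) (v : Fin m → ℝ) :
    (Lottery.item j x).utility v = v j - x := by
  simp [Lottery.utility, Lottery.item]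

section ItemPricing

variable {m : ℕ} {p v : Fin m → ℝ} {l : Lottery m}

theorem IsBestChoice.eq_noPurchase_or_item (h : IsBestChoice (itemPricing p) v l) :
    l = Lottery.noPurchase m ∨ ∃ j, l = Lottery.item j (p j) := by
  rcases h.1 with h | ⟨j, h⟩
  · exact Or.inl h
  · exact Or.inr ⟨j, h.symm⟩

theorem IsBestChoice.sub_le_utility (h : IsBestChoice (itemPricing p) v l) (j : Fin m) :
    v j - p j ≤ l.utility v := by
  rw [← Lottery.utility_item]
  exact h.2 _ (Or.inr ⟨j, rfl⟩)

theorem IsBestChoice.price_nonneg (h : IsBestChoice (itemPricing p) v l) (hp : ∀ j, 0 ≤ p j) :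
    0 ≤ l.price := by
  rcases h.eq_noPurchase_or_item with rfl | ⟨j, rfl⟩
  · exact le_rfl
  · exact hp j

theorem IsBestChoice.price_le_sum (h : IsBestChoice (itemPricing p) v l) (hp : ∀ j, 0 ≤ p j) :
    l.price ≤ ∑ j, p j := by
  rcases h.eq_noPurchase_or_item with rfl | ⟨j, rfl⟩
  · exact Finset.sum_nonneg fun j _ => hp j
  · exact Finset.single_le_sum (fun k _ => hp k) (Finset.mem_univ j)

theorem IsBestChoice.le_price (h : IsBestChoice (itemPricing p) v l) {ν : ℝ} (hp : ∀ j, ν ≤ p j)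
    {k : Fin m} (hk : p k < v k) : ν ≤ l.price := by
  rcases h.eq_noPurchase_or_item with rfl | ⟨j, rfl⟩
  · have := h.sub_le_utility k
    rw [Lottery.utility_noPurchase] at this
    linarith
  · exact hp j

theorem IsBestChoice.price_eq (h : IsBestChoice (itemPricing p) v l) {i : Fin m} (hi : p i < v i)
    (hk : ∀ k, k ≠ i → v k - p k < v i - p i) : l.price = p i := by
  have hu := h.sub_le_utility i
  rcases h.eq_noPurchase_or_item with rfl | ⟨j, rfl⟩
  · rw [Lottery.utility_noPurchase] at hu
    linarith
  · rw [Lottery.utility_item] at hu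
    by_cases hj : j = i
    · rw [hj]; rfl
    · exact absurd (hk j hj) (not_lt.2 hu)

end ItemPricing

theorem measurable_additiveValue {m : ℕ} : Measurable (additiveValue (m := m)) :=
  measurable_pi_lambda _ fun j => (measurable_pi_apply 0).add (measurable_pi_apply j.succ)

theorem ae_pi_nonneg {n : ℕ} {F : Fin n → Measure ℝ} [∀ i, IsProbabilityMeasure (F i)]
    (hnonneg : ∀ i, ∀ᵐ x ∂(F i), 0 ≤ x) : ∀ᵐ t ∂(Measure.pi F), ∀ i, 0 ≤ t i :=
  ae_all_iff.2 fun i => (Measure.quasiMeasurePreserving_eval F i).ae (hnonneg i)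

theorem IsRationalChoice.ae_isBestChoice {m : ℕ} {F : Fin (m + 1) → Measure ℝ}
    {L : LotteryPricing m} {c : (Fin m → ℝ) → Lottery m}
    (hc : IsRationalChoice (additiveValueLaw F) L c) :
    ∀ᵐ t ∂(Measure.pi F), IsBestChoice L (additiveValue t) (c (additiveValue t)) :=
  ae_of_ae_map measurable_additiveValue.aemeasurable hc.best

/-- A function of the type that bounds the price paid from below, however ties are broken, bounds
the revenue of an item pricing. -/
theorem integral_le_expectedRevenue {m : ℕ} {F : Fin (m + 1) → Measure ℝ}
    [∀ i, IsProbabilityMeasure (F i)] (hnonneg : ∀ i, ∀ᵐ x ∂(F i), 0 ≤ x) {p : Fin m → ℝ}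
    (hp : ∀ j, 0 ≤ p j) {d : (Fin m → ℝ) → Lottery m}
    (hd : IsRationalChoice (additiveValueLaw F) (itemPricing p) d) {g : (Fin (m + 1) → ℝ) → ℝ}
    (hg : Integrable g (Measure.pi F))
    (hgp : ∀ t l, (∀ i, 0 ≤ t i) → IsBestChoice (itemPricing p) (additiveValue t) l →
      g t ≤ l.price) :
    ∫ t, g t ∂(Measure.pi F) ≤ expectedRevenue (additiveValueLaw F) d := by
  have hbest := hd.ae_isBestChoice
  have hmeas : AEMeasurable (fun t => (d (additiveValue t)).price) (Measure.pi F) :=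
    hd.aemeasurable_price.comp_measurable measurable_additiveValue
  rw [expectedRevenue, additiveValueLaw, integral_map measurable_additiveValue.aemeasurable
    hd.aemeasurable_price.aestronglyMeasurable]
  refine integral_mono_ae hg ?_ ?_
  · refine Integrable.of_bound hmeas.aestronglyMeasurable (∑ j, p j) (hbest.mono fun t ht => ?_)
    rw [Real.norm_eq_abs, abs_of_nonneg (ht.price_nonneg hp)]
    exact ht.price_le_sum hp
  · filter_upwards [hbest, ae_pi_nonneg hnonneg] with t ht ht0 using hgp t _ ht0 ht

theorem expectedRevenue_itemPricing_nonneg {m : ℕ} {F : Fin (m + 1) → Measure ℝ}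
    [∀ i, IsProbabilityMeasure (F i)] (hnonneg : ∀ i, ∀ᵐ x ∂(F i), 0 ≤ x) {p : Fin m → ℝ}
    (hp : ∀ j, 0 ≤ p j) {d : (Fin m → ℝ) → Lottery m}
    (hd : IsRationalChoice (additiveValueLaw F) (itemPricing p) d) :
    0 ≤ expectedRevenue (additiveValueLaw F) d := by
  simpa using integral_le_expectedRevenue hnonneg hp hd (integrable_zero _ ℝ _)
    fun _ _ _ h => h.price_nonneg hp

/-- Posting the price `r` on every item sells whenever the base value exceeds `r`. -/
theorem base_posted_price_le_expectedRevenue {m : ℕ} {F : Fin (m + 1) → Measure ℝ}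
    [∀ i, IsProbabilityMeasure (F i)] (hnonneg : ∀ i, ∀ᵐ x ∂(F i), 0 ≤ x) (j : Fin m)
    {r : ℝ} (hr : 0 ≤ r) {d : (Fin m → ℝ) → Lottery m}
    (hd : IsRationalChoice (additiveValueLaw F) (itemPricing fun _ => r) d) :
    r * (F 0).real (Set.Ioi r) ≤ expectedRevenue (additiveValueLaw F) d := by
  classical
  have hs : MeasurableSet ((fun t : Fin (m + 1) → ℝ => t 0) ⁻¹' Set.Ioi r) :=
    measurable_pi_apply 0 measurableSet_Ioi
  have h := integral_le_expectedRevenue hnonneg (fun _ => hr) hd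
    (g := ((fun t : Fin (m + 1) → ℝ => t 0) ⁻¹' Set.Ioi r).indicator fun _ => r)
    ((integrable_const r).indicator hs) fun t l ht hl => by
      by_cases h0 : r < t 0
      · rw [Set.indicator_of_mem (by exact h0)]
        refine hl.le_price (fun _ => le_rfl) (k := j) ?_
        have := ht j.succ
        simp only [additiveValue]
        linarith
      · rw [Set.indicator_of_notMem (by exact h0)]
        exact hl.price_nonneg fun _ => hr
  rw [integral_indicator_const _ hs, smul_eq_mul,
    (measurePreserving_eval F 0).measureReal_preimage measurableSet_Ioi.nullMeasurableSet] at h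
  linarith

theorem measureReal_pi_pi {n : ℕ} (F : Fin n → Measure ℝ) [∀ i, IsProbabilityMeasure (F i)]
    (S : Fin n → Set ℝ) : (Measure.pi F).real (Set.pi Set.univ S) = ∏ i, (F i).real (S i) := by
  rw [measureReal_def, Measure.pi_pi, ENNReal.toReal_prod]
  rfl

/-- The revenue guarantee of item prices above a common reserve `ν`. Whenever some `t (j + 1)`
exceeds its price something is sold, for at least `ν`; and whenever `t (j + 1)` is the only one to
do so, item `j` is sold, whatever the base value, because it is then the favourite of the buyer.
Here `b` is the probability that no `t (j + 1)` exceeds its price. -/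
theorem item_prices_le_expectedRevenue {m : ℕ} {F : Fin (m + 1) → Measure ℝ}
    [∀ i, IsProbabilityMeasure (F i)] (hnonneg : ∀ i, ∀ᵐ x ∂(F i), 0 ≤ x) {p : Fin m → ℝ}
    {ν : ℝ} (hν : 0 ≤ ν) (hp : ∀ j, ν ≤ p j) {d : (Fin m → ℝ) → Lottery m}
    (hd : IsRationalChoice (additiveValueLaw F) (itemPricing p) d) :
    ∃ b : ℝ, 0 ≤ b ∧ b ≤ 1 ∧
      ν * (1 - b) + b * ∑ j, (p j - ν) * (F j.succ).real (Set.Ioi (p j)) ≤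
        expectedRevenue (additiveValueLaw F) d := by
  classical
  have hp0 : ∀ j, 0 ≤ p j := fun j => hν.trans (hp j)
  -- `N`: no item coordinate exceeds its price; `E j`: only the one of item `j` does.
  set A : Fin (m + 1) → Set ℝ := Fin.cons (α := fun _ => Set ℝ) Set.univ fun k => Set.Iic (p k)
    with hA
  set A' : Fin m → Fin (m + 1) → Set ℝ := fun j => Fin.cons (α := fun _ => Set ℝ) Set.univ
    fun k => if k = j then Set.Ioi (p k) else Set.Iic (p k) with hA'
  set N : Set (Fin (m + 1) → ℝ) := Set.pi Set.univ A with hN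
  set E : Fin m → Set (Fin (m + 1) → ℝ) := fun j => Set.pi Set.univ (A' j) with hE
  have hNmem : ∀ t, t ∈ N ↔ ∀ k : Fin m, t k.succ ≤ p k := by
    intro t
    simp [hN, hA, Set.mem_pi, Fin.forall_fin_succ]
  have hEmem : ∀ j t, t ∈ E j ↔ p j < t j.succ ∧ ∀ k : Fin m, k ≠ j → t k.succ ≤ p k := by
    intro j t
    simp only [hE, hA', Set.mem_pi, Set.mem_univ, true_imp_iff, Fin.forall_fin_succ, Fin.cons_zero,
      Fin.cons_succ, true_and]
    constructor
    · intro h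
      exact ⟨by simpa using h j, fun k hk => by simpa [hk] using h k⟩
    · rintro ⟨h1, h2⟩ k
      by_cases hk : k = j
      · subst hk; simpa using h1
      · simpa [hk] using h2 k hk
  have hNm : MeasurableSet N := MeasurableSet.univ_pi fun i =>
    Fin.cases MeasurableSet.univ (fun k => measurableSet_Iic) i
  have hEm : ∀ j, MeasurableSet (E j) := fun j => MeasurableSet.univ_pi fun i =>
    Fin.cases MeasurableSet.univ (fun k => by
      simp only [hA', Fin.cons_succ]
      split_ifs
      · exact measurableSet_Ioi
      · exact measurableSet_Iic) i
  have hNr : (Measure.pi F).real N = ∏ k : Fin m, (F k.succ).real (Set.Iic (p k)) := by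
    rw [hN, measureReal_pi_pi, Fin.prod_univ_succ]
    simp [hA]
  -- By independence, the others stay below their prices with probability at least that of `N`.
  have hEr : ∀ j, (F j.succ).real (Set.Ioi (p j)) * (Measure.pi F).real N ≤
      (Measure.pi F).real (E j) := by
    intro j
    rw [hNr, hE, measureReal_pi_pi, Fin.prod_univ_succ]
    simp only [hA', Fin.cons_zero, Fin.cons_succ, probReal_univ, one_mul]
    rw [← Finset.mul_prod_erase Finset.univ _ (Finset.mem_univ j),
      ← Finset.mul_prod_erase Finset.univ (fun k : Fin m => (F k.succ).real
        (if k = j then Set.Ioi (p k) else Set.Iic (p k))) (Finset.mem_univ j), if_pos rfl]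
    refine mul_le_mul_of_nonneg_left ?_ measureReal_nonneg
    refine (mul_le_of_le_one_left (Finset.prod_nonneg fun _ _ => measureReal_nonneg)
      measureReal_le_one).trans (le_of_eq (Finset.prod_congr rfl fun k hk => ?_))
    rw [if_neg (Finset.ne_of_mem_erase hk)]
  have hint1 : Integrable (Nᶜ.indicator fun _ => ν) (Measure.pi F) :=
    (integrable_const ν).indicator hNm.compl
  have hint2 : ∀ j ∈ Finset.univ, Integrable ((E j).indicator fun _ => p j - ν) (Measure.pi F) :=
    fun j _ => (integrable_const _).indicator (hEm j)
  have h := integral_le_expectedRevenue hnonneg hp0 hd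
    (g := fun t => Nᶜ.indicator (fun _ => ν) t + ∑ j, (E j).indicator (fun _ => p j - ν) t)
    (hint1.add (integrable_finsetSum _ hint2)) fun t l ht hl => by
      by_cases hEt : ∃ j, t ∈ E j
      · obtain ⟨j, hj⟩ := hEt
        have hj' := (hEmem j t).1 hj
        have htN : t ∈ Nᶜ := fun h => absurd ((hNmem t).1 h j) (not_le.2 hj'.1)
        rw [Finset.sum_eq_single j (fun k _ hk => Set.indicator_of_notMem (fun h =>
            absurd (hj'.2 k hk) (not_le.2 ((hEmem k t).1 h).1)) _) (by simp),
          Set.indicator_of_mem hj, Set.indicator_of_mem htN]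
        have := ht 0
        rw [hl.price_eq (i := j)]
        · linarith
        · have := hj'.1
          simp only [additiveValue]
          linarith
        · intro k hk
          have := hj'.1
          have := hj'.2 k hk
          simp only [additiveValue]
          linarith
      · rw [Finset.sum_eq_zero fun j _ => Set.indicator_of_notMem (fun h => hEt ⟨j, h⟩) _, add_zero]
        by_cases htN : t ∈ N
        · rw [Set.indicator_of_notMem (by simpa using htN)]
          exact hl.price_nonneg hp0
        · rw [Set.indicator_of_mem (by exact htN)]
          rw [hNmem] at htN
          push Not at htN
          obtain ⟨k, hk⟩ := htN
          refine hl.le_price hp (k := k) ?_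
          have := ht 0
          simp only [additiveValue]
          linarith
  rw [integral_add hint1 (integrable_finsetSum _ hint2), integral_finsetSum _ hint2,
    integral_indicator_const _ hNm.compl, probReal_compl_eq_one_sub hNm] at h
  refine ⟨(Measure.pi F).real N, measureReal_nonneg, measureReal_le_one, le_trans ?_ h⟩
  rw [smul_eq_mul, Finset.mul_sum]
  refine add_le_add (by linarith) (Finset.sum_le_sum fun j _ => ?_)
  rw [integral_indicator_const _ (hEm j), smul_eq_mul]
  have := mul_le_mul_of_nonneg_right (hEr j) (sub_nonneg.2 (hp j))
  linarith

/-- If every choice of arguments makes a finite sum at most `R`, then so do the suprema of the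
summands. -/
theorem exists_bounds_sum_le {ι α : Type*} [Fintype ι] [Nonempty α] (φ : ι → α → ℝ) {R : ℝ}
    (h : ∀ a : ι → α, ∑ i, φ i (a i) ≤ R) :
    ∃ G : ι → ℝ, ∑ i, G i ≤ R ∧ ∀ i a, φ i a ≤ G i := by
  classical
  obtain ⟨a₀⟩ := ‹Nonempty α›
  have : Nonempty α := ⟨a₀⟩
  have hbdd : ∀ i, BddAbove (Set.range (φ i)) := by
    intro i
    refine ⟨R - ∑ k ∈ Finset.univ.erase i, φ k a₀, ?_⟩
    rintro _ ⟨a, rfl⟩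
    have h1 := h (Function.update (fun _ => a₀) i a)
    rw [← Finset.add_sum_erase _ _ (Finset.mem_univ i), Function.update_self,
      Finset.sum_congr rfl fun k hk => by
        rw [Function.update_of_ne (Finset.ne_of_mem_erase hk)]] at h1
    linarith
  refine ⟨fun i => ⨆ a, φ i a, ?_, fun i a => le_ciSup (hbdd i) a⟩
  refine le_of_forall_pos_le_add fun ε hε => ?_
  set η := ε / (Fintype.card ι + 1) with hη
  have hη0 : 0 < η := by positivity
  choose a ha using fun i => exists_lt_of_lt_ciSup (sub_lt_self (⨆ a, φ i a) hη0)
  have hcard : (Fintype.card ι : ℝ) * η ≤ ε := by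
    rw [hη, mul_div_assoc', div_le_iff₀ (by positivity)]
    linarith
  calc ∑ i, ⨆ a, φ i a ≤ ∑ i, (φ i (a i) + η) :=
        Finset.sum_le_sum fun i _ => by linarith [ha i]
    _ = ∑ i, φ i (a i) + Fintype.card ι * η := by
        rw [Finset.sum_add_distrib, Finset.sum_const, Finset.card_univ, nsmul_eq_mul]
    _ ≤ R + ε := add_le_add (h a) hcard

/-- Let `R` bound the revenue of item pricings and take the reserve `ν = 5 R / 4`. Since `ν > R`,
the bound of `item_prices_le_expectedRevenue` cannot come from its first term alone, so that `b > 0`;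
dividing by `b` bounds the total profit of posted prices over the reserve by `R`. -/
theorem exists_item_profit_bounds {m : ℕ} {F : Fin (m + 1) → Measure ℝ}
    [∀ i, IsProbabilityMeasure (F i)] (hnonneg : ∀ i, ∀ᵐ x ∂(F i), 0 ≤ x) {R : ℝ} (hR0 : 0 < R)
    (hR : ∀ p : Fin m → ℝ, (∀ j, 0 ≤ p j) → ∃ d : (Fin m → ℝ) → Lottery m,
      IsRationalChoice (additiveValueLaw F) (itemPricing p) d ∧
        expectedRevenue (additiveValueLaw F) d ≤ R) :
    ∃ G : Fin m → ℝ, ∑ j, G j ≤ R ∧ ∀ j r, 5 / 4 * R ≤ r →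
      (r - 5 / 4 * R) * (F j.succ).real (Set.Ioi r) ≤ G j := by
  have : Nonempty (Set.Ici (5 / 4 * R)) := ⟨⟨5 / 4 * R, Set.self_mem_Ici⟩⟩
  obtain ⟨G, hG, hG'⟩ := exists_bounds_sum_le (α := Set.Ici (5 / 4 * R))
    (fun (j : Fin m) r => ((r : ℝ) - 5 / 4 * R) * (F j.succ).real (Set.Ioi (r : ℝ)))
    (R := R) fun p => by
      have hν : 0 ≤ 5 / 4 * R := by linarith
      obtain ⟨d, hd, hdR⟩ := hR (fun j => p j) fun j => hν.trans (p j).2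
      obtain ⟨b, hb0, hb1, hb⟩ := item_prices_le_expectedRevenue hnonneg hν (fun j => (p j).2) hd
      have hX : 0 ≤ ∑ j, ((p j : ℝ) - 5 / 4 * R) * (F j.succ).real (Set.Ioi (p j : ℝ)) :=
        Finset.sum_nonneg fun j _ => mul_nonneg (sub_nonneg.2 (p j).2) measureReal_nonneg
      set X := ∑ j, ((p j : ℝ) - 5 / 4 * R) * (F j.succ).real (Set.Ioi (p j : ℝ))
      have hbX : 5 / 4 * R * (1 - b) + b * X ≤ R := hb.trans hdR
      have hb' : 0 < b := by
        by_contra hneg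
        have : b = 0 := le_antisymm (not_lt.1 hneg) hb0
        rw [this] at hbX
        linarith
      have hbR : b * R ≤ R := mul_le_of_le_one_left hR0.le hb1
      exact le_of_mul_le_mul_left (by linarith : b * X ≤ b * R) hb'
  exact ⟨G, hG, fun j r hr => hG' j ⟨r, hr⟩⟩

theorem ofReal_mul_measure_le {μ : Measure ℝ} [IsFiniteMeasure μ] {a C : ℝ} (ha : 0 ≤ a)
    {s : Set ℝ} (h : a * μ.real s ≤ C) : ENNReal.ofReal a * μ s ≤ ENNReal.ofReal C := by
  rw [← ofReal_measureReal, ← ENNReal.ofReal_mul ha]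
  exact ENNReal.ofReal_le_ofReal h

/-! ### Comparison of lottery pricings with item pricings -/

/-- If no item pricing is guaranteed more than `R`, then the price paid under any lottery pricing
has positive part of expectation at most `15 R / 2`. -/
theorem lintegral_price_le {m : ℕ} {F : Fin (m + 1) → Measure ℝ}
    [∀ i, IsProbabilityMeasure (F i)] (hnonneg : ∀ i, ∀ᵐ x ∂(F i), 0 ≤ x) {R : ℝ} (hR0 : 0 < R)
    (hR : ∀ p : Fin m → ℝ, (∀ j, 0 ≤ p j) → ∃ d : (Fin m → ℝ) → Lottery m,
      IsRationalChoice (additiveValueLaw F) (itemPricing p) d ∧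
        expectedRevenue (additiveValueLaw F) d ≤ R)
    {L : LotteryPricing m} {c : (Fin m → ℝ) → Lottery m}
    (hc : IsRationalChoice (additiveValueLaw F) L c) :
    ∫⁻ v, ENNReal.ofReal (c v).price ∂(additiveValueLaw F) ≤ ENNReal.ofReal (15 / 2 * R) := by
  rw [additiveValueLaw, lintegral_map' hc.aemeasurable_price.ennreal_ofReal
    measurable_additiveValue.aemeasurable]
  have hbest := hc.ae_isBestChoice
  rcases Nat.eq_zero_or_pos m with rfl | hm
  · -- Without items, nothing can be sold at a positive price.
    have : ∫⁻ t, ENNReal.ofReal (c (additiveValue t)).price ∂(Measure.pi F) = 0 := by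
      refine lintegral_eq_zero_of_ae_eq_zero (hbest.mono fun t ht => ?_)
      have := ht.utility_nonneg
      simp only [Lottery.utility, Finset.univ_eq_empty, Finset.sum_empty, zero_sub] at this
      exact ENNReal.ofReal_of_nonpos (by linarith)
    rw [this]
    exact zero_le
  obtain ⟨t₀, ht₀⟩ := hbest.exists
  have hL : HasFiniteUtility L := ht₀.hasFiniteUtility
  obtain ⟨G, hG, hG'⟩ := exists_item_profit_bounds hnonneg hR0 hR
  set ν := 5 / 4 * R with hν
  have hν0 : 0 ≤ ν := by linarith
  have hG0 : ∀ j, 0 ≤ G j := fun j => by simpa using hG' j ν le_rfl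
  have hC0 : ∀ r, 0 ≤ r → ENNReal.ofReal (r - 0) * F 0 (Set.Ioi r) ≤ ENNReal.ofReal R := by
    intro r hr
    obtain ⟨d, hd, hdR⟩ := hR (fun _ => r) fun _ => hr
    rw [sub_zero]
    exact ofReal_mul_measure_le hr
      ((base_posted_price_le_expectedRevenue hnonneg ⟨0, hm⟩ hr hd).trans hdR)
  have hC : ∀ (j : Fin m) r, ν ≤ r →
      ENNReal.ofReal (r - ν) * F j.succ (Set.Ioi r) ≤ ENNReal.ofReal (G j) := fun j r hr =>
    ofReal_mul_measure_le (sub_nonneg.2 hr) (hG' j r hr)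
  -- The profits of the coordinates, regarded as agents.
  set Ψ : ℝ → Fin (m + 1) → (Fin (m + 1) → ℝ) → ENNReal := fun a i t =>
    ENNReal.ofReal ((t i - a) * (c (additiveValue t)).serviceProb i -
      (c (additiveValue t)).utility (additiveValue t))
  have hprob : ∀ j, AEMeasurable (fun t => (c (additiveValue t)).prob j) (Measure.pi F) :=
    fun j => (hc.aemeasurable_prob j).comp_measurable measurable_additiveValue
  have hserv : ∀ i, AEMeasurable (fun t => (c (additiveValue t)).serviceProb i)
      (Measure.pi F) := fun i =>
    Fin.cases (Finset.aemeasurable_fun_sum Finset.univ fun j _ => hprob j) (fun j => hprob j) i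
  have hutil : AEMeasurable (fun t => (c (additiveValue t)).utility (additiveValue t))
      (Measure.pi F) := by
    simp only [Lottery.utility_additiveValue]
    exact (Finset.aemeasurable_fun_sum _ fun i _ =>
      (hserv i).mul (measurable_pi_apply i).aemeasurable).sub
        (hc.aemeasurable_price.comp_measurable measurable_additiveValue)
  have hΨm : ∀ a i, AEMeasurable (Ψ a i) (Measure.pi F) := fun a i =>
    ((((measurable_pi_apply i).aemeasurable.sub_const a).mul (hserv i)).sub hutil).ennreal_ofReal
  have hSm : ∀ a i, Measurable fun t : Fin (m + 1) → ℝ =>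
      ENNReal.ofReal (secondPriceProfit a i t) := fun a i =>
    (measurable_secondPriceProfit a i).ennreal_ofReal
  calc ∫⁻ t, ENNReal.ofReal (c (additiveValue t)).price ∂(Measure.pi F)
      ≤ ∫⁻ t, (ENNReal.ofReal (2 * ν) + (Ψ 0 0 t + ENNReal.ofReal (secondPriceProfit 0 0 t)) +
          ∑ j : Fin m, (Ψ ν j.succ t + 2 * ENNReal.ofReal (secondPriceProfit ν j.succ t)))
            ∂(Measure.pi F) := by
        refine lintegral_mono_ae ((ae_pi_nonneg hnonneg).mono fun t ht => ?_)
        have hmax : ∀ x : ℝ, ENNReal.ofReal (max x 0) = ENNReal.ofReal x := fun x => by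
          rcases le_total x 0 with h | h
          · rw [max_eq_right h, ENNReal.ofReal_zero, ENNReal.ofReal_of_nonpos h]
          · rw [max_eq_left h]
        refine (ENNReal.ofReal_le_ofReal
          (price_le_decomposition (c (additiveValue t)) t ht hν0)).trans ?_
        refine ENNReal.ofReal_add_le.trans (add_le_add (ENNReal.ofReal_add_le.trans
          (add_le_add le_rfl (ENNReal.ofReal_add_le.trans (add_le_add ?_ le_rfl)))) ?_)
        · rw [hmax]
        · rw [ENNReal.ofReal_sum_of_nonneg fun j _ => add_nonneg (le_max_right _ _)
            (mul_nonneg zero_le_two (secondPriceProfit_nonneg _ _ _))]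
          refine Finset.sum_le_sum fun j _ => ENNReal.ofReal_add_le.trans (add_le_add ?_ ?_)
          · rw [hmax]
          · rw [ENNReal.ofReal_mul zero_le_two, ENNReal.ofReal_ofNat]
    _ = ENNReal.ofReal (2 * ν) + (∫⁻ t, Ψ 0 0 t ∂(Measure.pi F) +
          ∫⁻ t, ENNReal.ofReal (secondPriceProfit 0 0 t) ∂(Measure.pi F)) +
          ∑ j : Fin m, (∫⁻ t, Ψ ν j.succ t ∂(Measure.pi F) +
            2 * ∫⁻ t, ENNReal.ofReal (secondPriceProfit ν j.succ t) ∂(Measure.pi F)) := by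
        have hj : ∀ j : Fin m, AEMeasurable (fun t => Ψ ν j.succ t +
            2 * ENNReal.ofReal (secondPriceProfit ν j.succ t)) (Measure.pi F) := fun j =>
          (hΨm ν j.succ).add ((hSm ν j.succ).const_mul 2).aemeasurable
        rw [lintegral_add_right' _ (Finset.aemeasurable_fun_sum _ fun j _ => hj j),
          lintegral_add_left measurable_const, lintegral_add_left' (hΨm 0 0),
          lintegral_finsetSum' _ fun j _ => hj j, lintegral_const, measure_univ, mul_one]
        congr 1
        refine Finset.sum_congr rfl fun j _ => ?_
        rw [lintegral_add_left' (hΨm ν j.succ), lintegral_const_mul _ (hSm ν j.succ)]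
    _ ≤ ENNReal.ofReal (2 * ν) + (ENNReal.ofReal R + ENNReal.ofReal R) +
          ∑ j : Fin m, (ENNReal.ofReal (G j) + 2 * ENNReal.ofReal (G j)) := by
        gcongr with j
        · exact lintegral_coordinate_profit_le F hL c hbest 0 hC0
        · exact lintegral_secondPriceProfit_le F 0 hC0
        · exact lintegral_coordinate_profit_le F hL c hbest j.succ (hC j)
        · exact lintegral_secondPriceProfit_le F j.succ (hC j)
    _ = ENNReal.ofReal (2 * ν + (R + R) + 3 * ∑ j, G j) := by
        have h2 : ∀ j, ENNReal.ofReal (G j) + 2 * ENNReal.ofReal (G j) =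
            ENNReal.ofReal (3 * G j) := fun j => by
          rw [ENNReal.ofReal_mul (by norm_num), ENNReal.ofReal_ofNat]
          ring
        have h3 : 0 ≤ ∑ j, G j := Finset.sum_nonneg fun j _ => hG0 j
        simp only [h2]
        rw [← ENNReal.ofReal_sum_of_nonneg fun j _ => mul_nonneg zero_le_three (hG0 j),
          ← Finset.mul_sum, ENNReal.ofReal_add (by linarith) (by linarith),
          ENNReal.ofReal_add (by linarith) (by linarith), ENNReal.ofReal_add hR0.le hR0.le]
    _ ≤ ENNReal.ofReal (15 / 2 * R) := ENNReal.ofReal_le_ofReal (by linarith)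

/-- The price paid is bounded below, by the finiteness of the utility of a buyer with values `0`;
so only its positive part matters for integrability. -/
theorem hasFiniteRevenue_of_lintegral_lt_top {m : ℕ} {μ : Measure (Fin m → ℝ)}
    [IsProbabilityMeasure μ] {L : LotteryPricing m} {c : (Fin m → ℝ) → Lottery m}
    (hc : IsRationalChoice μ L c) (h : ∫⁻ v, ENNReal.ofReal (c v).price ∂μ < ⊤) :
    HasFiniteRevenue μ c := by
  obtain ⟨v₀, hv₀⟩ := hc.best.exists
  have hL := hv₀.hasFiniteUtility
  refine ⟨hc.aemeasurable_price.aestronglyMeasurable, ?_⟩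
  set K := indirectUtility L (0 : Fin m → ℝ)
  have hK : 0 ≤ K := hL.indirectUtility_nonneg _
  calc ∫⁻ v, ‖(c v).price‖ₑ ∂μ
      ≤ ∫⁻ v, (ENNReal.ofReal (c v).price + ENNReal.ofReal K) ∂μ := by
        refine lintegral_mono_ae (hc.best.mono fun v hv => ?_)
        have hp : -K ≤ (c v).price := by
          have := hL.utility_le hv.1 0
          simp only [Lottery.utility, Pi.zero_apply, mul_zero, Finset.sum_const_zero] at this
          linarith
        rw [Real.enorm_eq_ofReal_abs]
        rcases le_total 0 (c v).price with h0 | h0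
        · rw [abs_of_nonneg h0]
          exact le_self_add
        · rw [abs_of_nonpos h0]
          exact (ENNReal.ofReal_le_ofReal (by linarith)).trans le_add_self
    _ < ⊤ := by
        rw [lintegral_add_right _ measurable_const]
        simpa using h

theorem integral_le_of_lintegral_ofReal_le {α : Type*} [MeasurableSpace α] {μ : Measure α}
    {f : α → ℝ} (hf : Integrable f μ) {C : ℝ} (hC : 0 ≤ C)
    (h : ∫⁻ a, ENNReal.ofReal (f a) ∂μ ≤ ENNReal.ofReal C) : ∫ a, f a ∂μ ≤ C := by
  rw [integral_eq_lintegral_pos_part_sub_lintegral_neg_part hf]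
  have h1 := ENNReal.toReal_le_of_le_ofReal hC h
  have h2 : 0 ≤ (∫⁻ a, ENNReal.ofReal (-f a) ∂μ).toReal := ENNReal.toReal_nonneg
  linarith

theorem mainTheorem2 (m : ℕ) (F : Fin (m + 1) → Measure ℝ)
    [∀ i, IsProbabilityMeasure (F i)]
    (hnonneg : ∀ i, ∀ᵐ x ∂(F i), 0 ≤ x)
    (L : LotteryPricing m) (c : (Fin m → ℝ) → Lottery m)
    (hc : IsRationalChoice (additiveValueLaw F) L c) :
    (HasFiniteRevenue (additiveValueLaw F) c →
      ∃ p : Fin m → ℝ, (∀ j, 0 ≤ p j) ∧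
        ∀ d : (Fin m → ℝ) → Lottery m,
          IsRationalChoice (additiveValueLaw F) (itemPricing p) d →
            expectedRevenue (additiveValueLaw F) c ≤
              8 * expectedRevenue (additiveValueLaw F) d) ∧
    (¬ HasFiniteRevenue (additiveValueLaw F) c →
      ∀ K : ℝ, ∃ p : Fin m → ℝ, (∀ j, 0 ≤ p j) ∧
        ∀ d : (Fin m → ℝ) → Lottery m,
          IsRationalChoice (additiveValueLaw F) (itemPricing p) d →
            K ≤ expectedRevenue (additiveValueLaw F) d) := by
  constructor
  · intro hfin
    by_contra! hcon
    obtain ⟨d₀, hd₀, hlt₀⟩ := hcon (fun _ => 0) fun _ => le_rfl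
    have hpos := expectedRevenue_itemPricing_nonneg hnonneg (fun _ => le_rfl) hd₀
    set R := expectedRevenue (additiveValueLaw F) c / 8 with hR
    have hR0 : 0 < R := by linarith
    have h := lintegral_price_le hnonneg hR0 (fun p hp => by
      obtain ⟨d, hd, hlt⟩ := hcon p hp
      exact ⟨d, hd, by linarith⟩) hc
    have h' := integral_le_of_lintegral_ofReal_le hfin (by linarith) h
    change expectedRevenue (additiveValueLaw F) c ≤ _ at h'
    linarith
  · intro hinf K
    by_contra! hcon
    have : IsProbabilityMeasure (additiveValueLaw F) :=
      Measure.isProbabilityMeasure_map measurable_additiveValue.aemeasurable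
    refine hinf (hasFiniteRevenue_of_lintegral_lt_top hc
      (lt_of_le_of_lt (lintegral_price_le hnonneg (R := max K 1) (by simp) (fun p hp => ?_) hc)
        ENNReal.ofReal_lt_top))
    obtain ⟨d, hd, hlt⟩ := hcon p hp
    exact ⟨d, hd, hlt.le.trans (le_max_left _ _)⟩
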